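/- **Proposition 5.2 (discrete energy law and stability of TPS1).** *Setting.* Let $\Omega\subset\mathbb{R}^3$ be a bounded open set with $\Omega=\operatorname{int}(\overline\Omega)$ (for instance a polyhedral domain with Lipschitz boundary), and let $\mathcal{T}_h$ be a regular (conforming) finite tetrahedral mesh of $\Omega$, i.e. $\bigcup_{K\in\mathcal{T}_h}K=\overline\Omega$ and any two elements intersect in the convex hull of their common vertices. Let $\mathcal{N}_h$ be its set of vertices. Given $\kappa\ge1$ and $h>0$, the mesh is assumed $\kappa$-quasi-uniform with mesh size $h$: every $K\in\mathcal{T}_h$ contains a ball of diameter $\rho$ with $\operatorname{diam}(K)\le\kappa\rho$, and $\kappa^{-1}h\le\operatorname{diam}(K)\le h$. Let $\mathcal{S}^1(\mathcal{T}_h)$ be the space of continuous functions on $\overline\Omega$ that are affine on each $K$, with hat functions $\varphi_z$, $z\in\mathcal{N}_h$ ($\varphi_z(z')=\delta_{z,z'}$). Assume the angle condition $\langle\nabla\varphi_z,\nabla\varphi_{z'}\rangle\le0$ for all $z\ne z'$ in $\mathcal{N}_h$, where $\langle\cdot,\cdot\rangle$ is the $L^2(\Omega)$ scalar product; $\|\cdot\|$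 denotes the $L^2(\Omega)$ norm. Let $\alpha,\ell_{\rm ex},\ell_{\rm dm}>0$, $0\le\theta\le1$, $T>0$, $N\ge1$ an integer, $k=T/N$, and let $$\mathcal{E}(m)=\frac{\ell_{\rm ex}^2}{2}\|\nabla m\|^2+\frac{\ell_{\rm dm}}{2}\langle\operatorname{curl}m,m\rangle .$$ The iterates of TPS1 are $m_h^0,\dots,m_h^N\in\mathcal{S}^1(\mathcal{T}_h)^3$ and $v_h^0,\dots,v_h^{N-1}\in\mathcal{S}^1(\mathcal{T}_h)^3$ with $|m_h^0(z)|=1$ for all $z\in\mathcal{N}_h$ such that, for $0\le i\le N-1$, $v_h^i$ belongs to $\mathcal{K}_h(m_h^i)=\{\phi\in\mathcal{S}^1(\mathcal{T}_h)^3: m_h^i(z)\cdot\phi(z)=0\ \forall z\in\mathcal{N}_h\}$ and satisfies, for all $\phi\in\mathcal{K}_h(m_h^i)$, $$\alpha\langle v_h^i,\phi\rangle+\langle m_h^i\times v_h^i,\phi\rangle+\ell_{\rm ex}^2\theta k\langle\nabla v_h^i,\nabla\phi\rangle=-\ell_{\rm ex}^2\langle\nabla m_h^i,\nabla\phi\rangle-\frac{\ell_{\rm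 dm}}2\langle\operatorname{curl}m_h^i,\phi\rangle-\frac{\ell_{\rm dm}}2\langle m_h^i,\operatorname{curl}\phi\rangle,$$ and $m_h^{i+1}(z)=\dfrac{m_h^i(z)+k v_h^i(z)}{|m_h^i(z)+k v_h^i(z)|}$ for all $z\in\mathcal{N}_h$. *Claim.* (i) There exists a constant $C>0$ depending only on $\kappa$ and $\ell_{\rm dm}$ such that, for all $1\le j\le N$, $$\mathcal{E}(m_h^j)+(\alpha-Ch^{-1}k)\,k\sum_{i=0}^{j-1}\|v_h^i\|^2+\ell_{\rm ex}^2(\theta-\tfrac12)k^2\sum_{i=0}^{j-1}\|\nabla v_h^i\|^2\le\mathcal{E}(m_h^0).$$ (ii) There exists a constant $C'>0$ depending only on $\alpha$, $\kappa$ and $\ell_{\rm dm}$ such that, if $\tfrac12\le\theta\le1$, $k\le C'h$ and $\|m_h^0\|_{H^1(\Omega)}\le C_0$ for some $C_0>0$, then, for all $1\le j\le N$, $$\|m_h^j\|_{H^1(\Omega)}^2+k\sum_{i=0}^{j-1}\|v_h^i\|^2+(\theta-\tfrac12)k^2\sum_{i=0}^{j-1}\|\nabla v_h^i\|^2\le C'',$$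 where $C''>0$ depends only on $\alpha$, $C_0$, $\kappa$, $\ell_{\rm ex}$, $\ell_{\rm dm}$ and $|\Omega|$. -/

import Mathlib

open MeasureTheory
open scoped RealInnerProductSpace

noncomputable section

namespace TPS

/-- Euclidean three-space. -/
abbrev R3 : Type := EuclideanSpace ℝ (Fin 3)

/-- The `i`-th partial derivative of `u` at `x`. -/
def partialDeriv {V : Type*} [NormedAddCommGroup V] [NormedSpace ℝ V]
    (i : Fin 3) (u : R3 → V) (x : R3) : V :=
  fderiv ℝ u x (EuclideanSpace.single i 1)

/-- The curl of a vector field. -/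
def curl (u : R3 → R3) (x : R3) : R3 :=
  !₂[partialDeriv 1 u x 2 - partialDeriv 2 u x 1,
     partialDeriv 2 u x 0 - partialDeriv 0 u x 2,
     partialDeriv 0 u x 1 - partialDeriv 1 u x 0]

/-- The cross product of two vectors of Euclidean three-space. -/
def cross (a b : R3) : R3 :=
  WithLp.toLp 2 (crossProduct (WithLp.ofLp a) (WithLp.ofLp b))

/-- The `L²(Ω)` scalar product of vector fields. -/
def l2Inner (Ω : Set R3) (u w : R3 → R3) : ℝ :=
  ∫ x in Ω, ⟪u x, w x⟫

/-- The `L²(Ω)` (Frobenius) scalar product of the gradients of two functions with values in an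
inner product space (`ℝ` or `ℝ³` below). It is only used for continuous piecewise affine
functions; these are differentiable almost everywhere in `Ω`, and their weak gradient is the
almost everywhere defined classical one. -/
def gradInner {V : Type*} [NormedAddCommGroup V] [InnerProductSpace ℝ V]
    (Ω : Set R3) (u w : R3 → V) : ℝ :=
  ∫ x in Ω, ∑ i : Fin 3, ⟪partialDeriv i u x, partialDeriv i w x⟫

/-- The square of the `L²(Ω)` norm of a vector field. -/
def l2NormSq (Ω : Set R3) (u : R3 → R3) : ℝ := l2Inner Ω u u

/-- The square of the `L²(Ω)` norm of the gradient of a vector field. -/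
def gradNormSq (Ω : Set R3) (u : R3 → R3) : ℝ := gradInner Ω u u

/-- The `H¹(Ω)` norm of a vector field. -/
def h1Norm (Ω : Set R3) (u : R3 → R3) : ℝ :=
  Real.sqrt (l2NormSq Ω u + gradNormSq Ω u)

/-- The micromagnetic energy made of exchange and bulk Dzyaloshinskii-Moriya contributions. -/
def energy (Ω : Set R3) (ℓex ℓdm : ℝ) (m : R3 → R3) : ℝ :=
  ℓex ^ 2 / 2 * gradNormSq Ω m + ℓdm / 2 * l2Inner Ω (curl m) m

/-- A regular (conforming) tetrahedral mesh of `Ω`. An element is given by the set of its four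
vertices, the tetrahedron being their convex hull. Two elements meet in the convex hull of their
common vertices, i.e. in the empty set, a common vertex, a common edge or a common face, unless
they are equal. -/
structure TetMesh (Ω : Set R3) where
  elems : Finset (Finset R3)
  card_eq_four : ∀ K ∈ elems, K.card = 4
  affineIndependent : ∀ K ∈ elems, AffineIndependent ℝ ((↑) : K → R3)
  inter_eq : ∀ K ∈ elems, ∀ L ∈ elems,
    convexHull ℝ (K : Set R3) ∩ convexHull ℝ (L : Set R3) =
      convexHull ℝ ((K : Set R3) ∩ (L : Set R3))
  iUnion_eq : ⋃ K ∈ elems, convexHull ℝ (K : Set R3) = closure Ω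

namespace TetMesh

variable {Ω : Set R3}

/-- The set of vertices of the mesh. -/
def nodes (M : TetMesh Ω) : Set R3 := {z | ∃ K ∈ M.elems, z ∈ K}

/-- `κ`-quasi-uniformity with mesh size `h`: every element `K` contains a ball of diameter `ρ`
with `diam K ≤ κ ρ` (`κ`-shape-regularity) and satisfies `κ⁻¹ h ≤ diam K ≤ h`. -/
def QuasiUniform (M : TetMesh Ω) (κ h : ℝ) : Prop :=
  ∀ K ∈ M.elems,
    (∃ (c : R3) (ρ : ℝ), Metric.closedBall c (ρ / 2) ⊆ convexHull ℝ (K : Set R3) ∧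
      Metric.diam (convexHull ℝ (K : Set R3)) ≤ κ * ρ) ∧
    κ⁻¹ * h ≤ Metric.diam (convexHull ℝ (K : Set R3)) ∧
    Metric.diam (convexHull ℝ (K : Set R3)) ≤ h

/-- Continuous piecewise affine functions on the mesh: for `V = ℝ` this is the space
`S¹(𝒯)`, for `V = ℝ³` it is `S¹(𝒯)³`. Values outside the closure of `Ω` are irrelevant. -/
def IsP1 {V : Type*} [NormedAddCommGroup V] [NormedSpace ℝ V]
    (M : TetMesh Ω) (u : R3 → V) : Prop :=
  ContinuousOn u (closure Ω) ∧
    ∀ K ∈ M.elems, ∃ a : R3 →ᵃ[ℝ] V, Set.EqOn u a (convexHull ℝ (K : Set R3))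

/-- `φ` is the nodal hat function of the vertex `z`. -/
def IsHat (M : TetMesh Ω) (z : R3) (φ : R3 → ℝ) : Prop :=
  M.IsP1 φ ∧ φ z = 1 ∧ ∀ z' ∈ M.nodes, z' ≠ z → φ z' = 0

/-- The angle condition: the off-diagonal entries of the stiffness matrix are nonpositive. -/
def AngleCondition (M : TetMesh Ω) : Prop :=
  ∀ z ∈ M.nodes, ∀ z' ∈ M.nodes, z ≠ z' →
    ∀ φ φ' : R3 → ℝ, M.IsHat z φ → M.IsHat z' φ' → gradInner Ω φ φ' ≤ 0

/-- The set `ℳ_h` of admissible discrete magnetizations. -/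
def Admissible (M : TetMesh Ω) : Set (R3 → R3) :=
  {φ | M.IsP1 φ ∧ ∀ z ∈ M.nodes, ‖φ z‖ = 1}

/-- The discrete tangent space `𝒦_h(ψ)` of `ψ`. -/
def tangentSpace (M : TetMesh Ω) (ψ : R3 → R3) : Set (R3 → R3) :=
  {φ | M.IsP1 φ ∧ ∀ z ∈ M.nodes, ⟪ψ z, φ z⟫ = 0}

/-- `m 0, …, m N` and `v 0, …, v (N - 1)` are the iterates of the first-order tangent plane
scheme TPS1 with time-step size `k`. -/
structure IsTPS1 (M : TetMesh Ω) (α ℓex ℓdm θ k : ℝ) (N : ℕ) (m v : ℕ → R3 → R3) : Prop where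
  initial : m 0 ∈ M.Admissible
  tangent : ∀ i < N, v i ∈ M.tangentSpace (m i)
  variational : ∀ i < N, ∀ φ ∈ M.tangentSpace (m i),
    α * l2Inner Ω (v i) φ + l2Inner Ω (fun x => cross (m i x) (v i x)) φ
        + ℓex ^ 2 * θ * k * gradInner Ω (v i) φ
      = - ℓex ^ 2 * gradInner Ω (m i) φ
        - ℓdm / 2 * l2Inner Ω (curl (m i)) φ
        - ℓdm / 2 * l2Inner Ω (m i) (curl φ)
  isP1_succ : ∀ i < N, M.IsP1 (m (i + 1))
  update : ∀ i < N, ∀ z ∈ M.nodes,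
    m (i + 1) z = ‖m i z + k • v i z‖⁻¹ • (m i z + k • v i z)

end TetMesh

end TPS

end

/-! Tangency makes `v` itself an admissible test function. The cross-product term then vanishes
pointwise, and `k` times the tested equation accounts for the first-order change of the energy from
m to m + k v. Both Dzyaloshinskii-Moriya terms match without integration by parts, so only the
second-order terms and the normalization remain.

Exchange: hat functions sum to one, hence ‖∇w‖² = -½ Σ ⟨∇φ_y, ∇φ_z⟩ |w(y) - w(z)|². The angle
condition makes the off-diagonal weights nonnegative. By orthogonality |m + k v| ≥ 1 at the nodes,
where radial projection is a contraction; so normalization cannot increase the exchange energy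
(`gradNormSq_le_of_norm_sub_le`).

Dzyaloshinskii-Moriya: at each node the increment is at most k|v| and differs from k v by at most
k²|v|²/2. An inverse estimate for the curl, costing κ²/h, and a comparison of the largest nodal
value with the mean square bound the remainder by a multiple of h⁻¹k²‖v‖²
(`l2Inner_curl_increment_le`).

Summing over the steps gives the energy law. For stability, Young's inequality absorbs the
indefinite energy into half of the exchange energy and an L² term, which |m| ≤ 1 bounds by the
volume. -/

namespace TPS

/-! ### Affine maps on convex hulls and balls. -/

section AffineMaps

variable {V : Type*} [NormedAddCommGroup V] [NormedSpace ℝ V]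

/-- Affine maps that agree on a set agree on its convex hull. -/
theorem eqOn_convexHull_of_eqOn {a b : R3 →ᵃ[ℝ] V} {s : Set R3} (hab : Set.EqOn a b s) :
    Set.EqOn a b (convexHull ℝ s) := fun _ hx =>
  AffineMap.eqOn_affineSpan hab (convexHull_subset_affineSpan s hx)

/-- An affine map on a convex hull takes values bounded by those on the generating set. -/
theorem norm_affineMap_le_of_mem_convexHull {a : R3 →ᵃ[ℝ] V} {s : Set R3} {A : ℝ}
    (ha : ∀ z ∈ s, ‖a z‖ ≤ A) {x : R3} (hx : x ∈ convexHull ℝ s) : ‖a x‖ ≤ A := by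
  have h1 : a x ∈ convexHull ℝ (a '' s) := by
    rw [← AffineMap.image_convexHull]
    exact Set.mem_image_of_mem a hx
  have h2 : convexHull ℝ (a '' s) ⊆ Metric.closedBall 0 A := by
    refine convexHull_min ?_ (convex_closedBall _ _)
    rintro _ ⟨z, hz, rfl⟩
    simpa using ha z hz
  simpa using h2 h1

theorem fderiv_eq_of_eqOn_affineMap {u : R3 → V} {a : R3 →ᵃ[ℝ] V} {s : Set R3}
    (hu : Set.EqOn u a s) {x : R3} (hx : x ∈ interior s) (e : R3) :
    fderiv ℝ u x e = a.linear e := by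
  have h1 : u =ᶠ[nhds x] a := by
    filter_upwards [mem_interior_iff_mem_nhds.1 hx] with y hy using hu hy
  rw [h1.fderiv_eq]
  let a' : R3 →ᴬ[ℝ] V := ⟨a, a.continuous_of_finiteDimensional⟩
  have h2 : HasFDerivAt a a'.contLinear x := a'.hasFDerivAt
  rw [h2.fderiv]
  rfl

theorem partialDeriv_eq_of_eqOn_affineMap {u : R3 → V} {a : R3 →ᵃ[ℝ] V} {s : Set R3}
    (hu : Set.EqOn u a s) {x : R3} (hx : x ∈ interior s) (i : Fin 3) :
    partialDeriv i u x = a.linear (EuclideanSpace.single i 1) :=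
  fderiv_eq_of_eqOn_affineMap hu hx _

/-- The linear part of an affine map that is bounded on a ball. -/
theorem norm_linear_le_of_closedBall {a : R3 →ᵃ[ℝ] V} {c : R3} {ρ A : ℝ} (hρ : 0 < ρ)
    (ha : ∀ x ∈ Metric.closedBall c (ρ / 2), ‖a x‖ ≤ A) {e : R3} (he : ‖e‖ = 1) :
    ‖a.linear e‖ ≤ 2 * A / ρ := by
  have hmem : ∀ t : ℝ, |t| ≤ ρ / 2 → t • e + c ∈ Metric.closedBall c (ρ / 2) := by
    intro t ht
    simpa [norm_smul, he] using ht
  have h1 := ha _ (hmem (ρ / 2) (by rw [abs_of_pos (by positivity)]))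
  have h2 := ha _ (hmem (-(ρ / 2)) (by rw [abs_neg, abs_of_pos (by positivity)]))
  -- The linear part is read off from the values at two antipodal points of the ball.
  have h3 : ρ • a.linear e = a ((ρ / 2) • e + c) - a ((-(ρ / 2)) • e + c) := by
    have key : ∀ t : ℝ, a (t • e + c) = t • a.linear e + a c := by
      intro t
      have := a.map_vadd c (t • e)
      simpa using this
    rw [key, key, add_sub_add_right_eq_sub, ← sub_smul]
    congr 1
    ring
  have h4 : ρ * ‖a.linear e‖ ≤ 2 * A := by
    calc ρ * ‖a.linear e‖ = ‖ρ • a.linear e‖ := by rw [norm_smul, Real.norm_of_nonneg hρ.le]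
      _ ≤ ‖a ((ρ / 2) • e + c)‖ + ‖a ((-(ρ / 2)) • e + c)‖ := by rw [h3]; exact norm_sub_le _ _
      _ ≤ 2 * A := by linarith
  rw [le_div_iff₀ hρ]
  linarith

end AffineMaps

/-! ### Decomposition of the domain into open tetrahedra. -/

/-- The open tetrahedron spanned by the vertices `K`. -/
abbrev cell (K : Finset R3) : Set R3 := interior (convexHull ℝ (K : Set R3))

theorem isCompact_convexHull_finset (K : Finset R3) :
    IsCompact (convexHull ℝ (K : Set R3)) :=
  K.finite_toSet.isCompact_convexHull ℝ

theorem measurableSet_cell (K : Finset R3) : MeasurableSet (cell K) :=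
  isOpen_interior.measurableSet

theorem cell_ae_eq_convexHull (K : Finset R3) :
    (cell K : Set R3) =ᵐ[volume] (convexHull ℝ (K : Set R3) : Set R3) :=
  interior_ae_eq_of_null_frontier ((convex_convexHull ℝ _).addHaar_frontier volume)

theorem volume_cell_lt_top (K : Finset R3) : volume (cell K) < ⊤ :=
  lt_of_le_of_lt (measure_mono interior_subset)
    (isCompact_convexHull_finset K).measure_lt_top

namespace TetMesh

variable {Ω : Set R3} (M : TetMesh Ω)

theorem convexHull_subset_closure {K : Finset R3} (hK : K ∈ M.elems) :
    convexHull ℝ (K : Set R3) ⊆ closure Ω := by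
  rw [← M.iUnion_eq]
  exact Set.subset_biUnion_of_mem (u := fun L : Finset R3 => convexHull ℝ (L : Set R3)) hK

theorem mem_nodes {K : Finset R3} (hK : K ∈ M.elems) {z : R3} (hz : z ∈ K) : z ∈ M.nodes :=
  ⟨K, hK, hz⟩

theorem cell_subset (hΩ : interior (closure Ω) = Ω) {K : Finset R3} (hK : K ∈ M.elems) :
    cell K ⊆ Ω := by
  rw [← hΩ]
  exact interior_mono (M.convexHull_subset_closure hK)

theorem affineSpan_eq_top {K : Finset R3} (hK : K ∈ M.elems) :
    affineSpan ℝ (Set.range ((↑) : K → R3)) = ⊤ := by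
  rw [(M.affineIndependent K hK).affineSpan_eq_top_iff_card_eq_finrank_add_one]
  simp [M.card_eq_four K hK]

/-- By conformity the intersection is the interior of the hull of the common vertices. Were it
nonempty, those vertices would span the space; but some vertex of `K` is not shared, and affine
independence keeps it out of the span of the others. -/
theorem disjoint_cell {K L : Finset R3} (hK : K ∈ M.elems) (hL : L ∈ M.elems) (hKL : K ≠ L) :
    Disjoint (cell K) (cell L) := by
  rw [Set.disjoint_iff_inter_eq_empty]
  unfold cell
  rw [← interior_inter, M.inter_eq K hK L hL, ← Set.not_nonempty_iff_eq_empty,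
    interior_convexHull_nonempty_iff_affineSpan_eq_top]
  intro htop
  obtain ⟨z, hzK, hzL⟩ : ∃ z ∈ K, z ∉ L := by
    by_contra! hsub
    exact hKL (Finset.eq_of_subset_of_card_le hsub
      (by rw [M.card_eq_four K hK, M.card_eq_four L hL]))
  have h1 := (M.affineIndependent K hK).notMem_affineSpan_sdiff ⟨z, hzK⟩ Set.univ
  apply h1
  have h2 : (K : Set R3) ∩ L ⊆ ((↑) : K → R3) '' (Set.univ \ {⟨z, hzK⟩}) := by
    rintro y ⟨hyK, hyL⟩
    refine ⟨⟨y, hyK⟩, ⟨trivial, ?_⟩, rfl⟩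
    intro h
    have : y = z := congrArg Subtype.val h
    exact hzL (this ▸ hyL)
  apply affineSpan_mono ℝ h2
  rw [htop]
  trivial

/-- The closed elements cover the closure, so only points on their frontiers are lost, and the
frontier of a convex set is null. -/
theorem ae_eq_iUnion_cell (hΩ : interior (closure Ω) = Ω) :
    Ω =ᵐ[volume] ⋃ K ∈ M.elems, cell K := by
  have hsub : ⋃ K ∈ M.elems, cell K ⊆ Ω := Set.iUnion₂_subset fun K hK => M.cell_subset hΩ hK
  refine Filter.EventuallyLE.antisymm ?_ hsub.eventuallyLE
  rw [ae_le_set]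
  refine measure_mono_null (t := ⋃ K ∈ M.elems, frontier (convexHull ℝ (K : Set R3))) ?_ ?_
  · rintro x ⟨hx, hx'⟩
    have hx2 : x ∈ closure Ω := subset_closure hx
    rw [← M.iUnion_eq] at hx2
    simp only [Set.mem_iUnion, not_exists] at hx2 hx' ⊢
    obtain ⟨K, hK, hxK⟩ := hx2
    exact ⟨K, hK, subset_closure hxK, hx' K hK⟩
  · refine (measure_biUnion_null_iff M.elems.countable_toSet).2 ?_
    exact fun K _ => (convex_convexHull ℝ _).addHaar_frontier volume

/-! ### Elementwise integration of piecewise continuous functions. -/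

/-- Functions that are continuous up to the boundary on the interior of each element. -/
def PwCont {V : Type*} [TopologicalSpace V] (f : R3 → V) : Prop :=
  ∀ K ∈ M.elems, ∃ g : R3 → V, Continuous g ∧ Set.EqOn f g (cell K)

variable {M}

section PwCont

theorem PwCont.comp₂ {V W X : Type*} [TopologicalSpace V] [TopologicalSpace W]
    [TopologicalSpace X] {f : R3 → V} {g : R3 → W} (hf : M.PwCont f) (hg : M.PwCont g)
    {F : V → W → X} (hF : Continuous fun p : V × W => F p.1 p.2) :
    M.PwCont fun x => F (f x) (g x) := by
  intro K hK
  obtain ⟨f', hf', hff'⟩ := hf K hK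
  obtain ⟨g', hg', hgg'⟩ := hg K hK
  refine ⟨fun x => F (f' x) (g' x), hF.comp (hf'.prodMk hg'), fun x hx => ?_⟩
  simp only [hff' hx, hgg' hx]

theorem PwCont.sum {V ι : Type*} [NormedAddCommGroup V] (s : Finset ι) {f : ι → R3 → V}
    (hf : ∀ i ∈ s, M.PwCont (f i)) : M.PwCont fun x => ∑ i ∈ s, f i x := by
  intro K hK
  choose! g hg hfg using fun i (hi : i ∈ s) => hf i hi K hK
  exact ⟨fun x => ∑ i ∈ s, g i x, continuous_finsetSum s hg,
    fun x hx => Finset.sum_congr rfl fun i hi => hfg i hi hx⟩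

theorem PwCont.add {V : Type*} [NormedAddCommGroup V] {f g : R3 → V}
    (hf : M.PwCont f) (hg : M.PwCont g) : M.PwCont fun x => f x + g x :=
  hf.comp₂ hg continuous_add

theorem PwCont.inner {V : Type*} [NormedAddCommGroup V] [InnerProductSpace ℝ V] {f g : R3 → V}
    (hf : M.PwCont f) (hg : M.PwCont g) : M.PwCont fun x => ⟪f x, g x⟫ :=
  hf.comp₂ hg continuous_inner

theorem pwCont_const {V : Type*} [TopologicalSpace V] (c : V) : M.PwCont fun _ => c :=
  fun _ _ => ⟨fun _ => c, continuous_const, fun _ _ => rfl⟩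

theorem PwCont.const_mul {f : R3 → ℝ} (hf : M.PwCont f) (c : ℝ) : M.PwCont fun x => c * f x :=
  (pwCont_const c).comp₂ hf continuous_mul

theorem PwCont.integrableOn_cell {f : R3 → ℝ} (hf : M.PwCont f) {K : Finset R3}
    (hK : K ∈ M.elems) : IntegrableOn f (cell K) := by
  obtain ⟨g, hg, hfg⟩ := hf K hK
  rw [integrableOn_congr_fun hfg (measurableSet_cell K)]
  exact (hg.continuousOn.integrableOn_compact (isCompact_convexHull_finset K)).mono_set
    interior_subset

theorem PwCont.integrableOn {f : R3 → ℝ} (hf : M.PwCont f) (hΩ : interior (closure Ω) = Ω) :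
    IntegrableOn f Ω := by
  rw [integrableOn_congr_set_ae (M.ae_eq_iUnion_cell hΩ), integrableOn_finset_iUnion]
  exact fun K hK => hf.integrableOn_cell hK

theorem PwCont.setIntegral_eq_sum {f : R3 → ℝ} (hf : M.PwCont f)
    (hΩ : interior (closure Ω) = Ω) : ∫ x in Ω, f x = ∑ K ∈ M.elems, ∫ x in cell K, f x := by
  rw [setIntegral_congr_set (M.ae_eq_iUnion_cell hΩ)]
  exact integral_biUnion_finset M.elems (fun K _ => measurableSet_cell K)
    (fun K hK L hL hKL => M.disjoint_cell hK hL hKL) fun K hK => hf.integrableOn_cell hK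

theorem PwCont.setIntegral_mono {f g : R3 → ℝ} (hf : M.PwCont f) (hg : M.PwCont g)
    (hΩ : interior (closure Ω) = Ω)
    (hfg : ∀ K ∈ M.elems, ∀ x ∈ cell K, f x ≤ g x) : ∫ x in Ω, f x ≤ ∫ x in Ω, g x := by
  rw [hf.setIntegral_eq_sum hΩ, hg.setIntegral_eq_sum hΩ]
  exact Finset.sum_le_sum fun K hK => setIntegral_mono_on (hf.integrableOn_cell hK)
    (hg.integrableOn_cell hK) (measurableSet_cell K) (hfg K hK)

theorem PwCont.setIntegral_congr {f g : R3 → ℝ} (hf : M.PwCont f) (hg : M.PwCont g)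
    (hΩ : interior (closure Ω) = Ω)
    (hfg : ∀ K ∈ M.elems, ∀ x ∈ cell K, f x = g x) : ∫ x in Ω, f x = ∫ x in Ω, g x :=
  le_antisymm (hf.setIntegral_mono hg hΩ fun K hK x hx => (hfg K hK x hx).le)
    (hg.setIntegral_mono hf hΩ fun K hK x hx => (hfg K hK x hx).ge)

end PwCont

/-! ### Piecewise affine functions, nodal interpolation and hat functions. -/

section IsP1

variable {V : Type*} [NormedAddCommGroup V]

theorem IsP1.pwCont [NormedSpace ℝ V] {u : R3 → V} (hu : M.IsP1 u) : M.PwCont u := by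
  intro K hK
  obtain ⟨a, ha⟩ := hu.2 K hK
  exact ⟨a, a.continuous_of_finiteDimensional, ha.mono interior_subset⟩

theorem IsP1.pwCont_partialDeriv [NormedSpace ℝ V] {u : R3 → V} (hu : M.IsP1 u) (i : Fin 3) :
    M.PwCont (partialDeriv i u) := by
  intro K hK
  obtain ⟨a, ha⟩ := hu.2 K hK
  exact ⟨fun _ => a.linear (EuclideanSpace.single i 1), continuous_const,
    fun x hx => partialDeriv_eq_of_eqOn_affineMap ha hx i⟩

theorem IsP1.pwCont_gradInner [InnerProductSpace ℝ V] {u w : R3 → V} (hu : M.IsP1 u)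
    (hw : M.IsP1 w) :
    M.PwCont fun x => ∑ i : Fin 3, ⟪partialDeriv i u x, partialDeriv i w x⟫ :=
  PwCont.sum _ fun i _ => (hu.pwCont_partialDeriv i).inner (hw.pwCont_partialDeriv i)

theorem IsP1.add [NormedSpace ℝ V] {u w : R3 → V} (hu : M.IsP1 u) (hw : M.IsP1 w) :
    M.IsP1 fun x => u x + w x := by
  refine ⟨hu.1.add hw.1, fun K hK => ?_⟩
  obtain ⟨a, ha⟩ := hu.2 K hK
  obtain ⟨b, hb⟩ := hw.2 K hK
  exact ⟨a + b, fun x hx => by simp [ha hx, hb hx]⟩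

theorem IsP1.const_smul [NormedSpace ℝ V] {u : R3 → V} (hu : M.IsP1 u) (c : ℝ) :
    M.IsP1 fun x => c • u x := by
  refine ⟨hu.1.const_smul c, fun K hK => ?_⟩
  obtain ⟨a, ha⟩ := hu.2 K hK
  exact ⟨c • a, fun x hx => by simp [ha hx]⟩

end IsP1

/-- Scalar nodal interpolation: every prescription of nodal values is attained by a continuous
piecewise affine function. -/
theorem exists_isP1_eq_on_nodes (M : TetMesh Ω) (f : R3 → ℝ) :
    ∃ u : R3 → ℝ, M.IsP1 u ∧ ∀ z ∈ M.nodes, u z = f z := by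
  classical
  -- On one element the interpolant is the combination of barycentric coordinates weighted by the
  -- nodal values.
  have hex : ∀ K ∈ M.elems, ∃ a : R3 →ᵃ[ℝ] ℝ, ∀ z ∈ K, a z = f z := by
    intro K hK
    let b : AffineBasis K ℝ R3 := ⟨(↑), M.affineIndependent K hK, M.affineSpan_eq_top hK⟩
    refine ⟨∑ y : K, f y • b.coord y, fun z hz => ?_⟩
    have hb : ∀ y : K, b.coord y z = if y = ⟨z, hz⟩ then 1 else 0 := fun y =>
      b.coord_apply y ⟨z, hz⟩
    have happ : (∑ y : K, f y • b.coord y) z = ∑ y : K, f y * b.coord y z := by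
      have := map_sum (AddMonoidHom.mk' (fun g : R3 →ᵃ[ℝ] ℝ => g z) fun _ _ => rfl)
        (fun y : K => f y • b.coord y) Finset.univ
      exact this
    rw [happ]
    simp [hb]
  choose! a ha using hex
  -- Two elements meet in the hull of their common vertices, where the local interpolants coincide;
  -- hence they glue continuously over a finite closed cover.
  have hagree : ∀ K ∈ M.elems, ∀ L ∈ M.elems, ∀ x ∈ convexHull ℝ (K : Set R3),
      x ∈ convexHull ℝ (L : Set R3) → a K x = a L x := by
    intro K hK L hL x hxK hxL
    have hx : x ∈ convexHull ℝ ((K : Set R3) ∩ L) := by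
      rw [← M.inter_eq K hK L hL]
      exact ⟨hxK, hxL⟩
    refine eqOn_convexHull_of_eqOn (fun z hz => ?_) hx
    rw [ha K hK z hz.1, ha L hL z hz.2]
  let u : R3 → ℝ := fun x =>
    if hx : ∃ K ∈ M.elems, x ∈ convexHull ℝ (K : Set R3) then a hx.choose x else 0
  have hu : ∀ K ∈ M.elems, Set.EqOn u (a K) (convexHull ℝ (K : Set R3)) := by
    intro K hK x hx
    have hx' : ∃ K ∈ M.elems, x ∈ convexHull ℝ (K : Set R3) := ⟨K, hK, hx⟩
    simp only [u, dif_pos hx']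
    exact hagree _ hx'.choose_spec.1 K hK x hx'.choose_spec.2 hx
  refine ⟨u, ⟨?_, fun K hK => ⟨a K, hu K hK⟩⟩, ?_⟩
  · rw [← M.iUnion_eq]
    have : ⋃ K ∈ M.elems, convexHull ℝ (K : Set R3) =
        ⋃ K : M.elems, convexHull ℝ ((K : Finset R3) : Set R3) := by
      ext x
      simp
    rw [this]
    exact (locallyFinite_of_finite _).continuousOn_iUnion
      (fun K => (isCompact_convexHull_finset K).isClosed)
      fun K => ((a K).continuous_of_finiteDimensional.continuousOn).congr (hu K K.2)
  · rintro z ⟨K, hK, hz⟩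
    rw [hu K hK (subset_convexHull ℝ _ hz), ha K hK z hz]

/-- The angle condition quantifies over hat functions, so it can be applied only once they exist. -/
theorem exists_isHat (M : TetMesh Ω) {z : R3} (hz : z ∈ M.nodes) : ∃ φ, M.IsHat z φ := by
  classical
  obtain ⟨φ, hφ, hφ'⟩ := M.exists_isP1_eq_on_nodes fun y => if y = z then 1 else 0
  refine ⟨φ, hφ, ?_, fun y hy hyz => ?_⟩
  · simp [hφ' z hz]
  · simp [hφ' y hy, hyz]

end TetMesh

namespace TetMesh

variable {Ω : Set R3} {M : TetMesh Ω}

section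

variable {V : Type*} [NormedAddCommGroup V] [NormedSpace ℝ V]

theorem isP1_const (c : V) : M.IsP1 fun _ => c :=
  ⟨continuousOn_const, fun _ _ => ⟨AffineMap.const ℝ R3 c, fun _ _ => rfl⟩⟩

theorem IsP1.smul_const {f : R3 → ℝ} (hf : M.IsP1 f) (c : V) : M.IsP1 fun x => f x • c := by
  refine ⟨hf.1.smul continuousOn_const, fun K hK => ?_⟩
  obtain ⟨a, ha⟩ := hf.2 K hK
  exact ⟨(LinearMap.toSpanSingleton ℝ V c).toAffineMap.comp a, fun x hx => by simp [ha hx]⟩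

theorem IsP1.sum {ι : Type*} (s : Finset ι) {f : ι → R3 → V} (hf : ∀ i ∈ s, M.IsP1 (f i)) :
    M.IsP1 fun x => ∑ i ∈ s, f i x := by
  classical
  induction s using Finset.induction_on with
  | empty => simpa using isP1_const (M := M) (0 : V)
  | insert i s hi ih =>
    simp only [Finset.sum_insert hi]
    exact (hf i (Finset.mem_insert_self i s)).add
      (ih fun j hj => hf j (Finset.mem_insert_of_mem hj))

theorem IsP1.differentiableAt {u : R3 → V} (hu : M.IsP1 u) {K : Finset R3} (hK : K ∈ M.elems)
    {x : R3} (hx : x ∈ cell K) : DifferentiableAt ℝ u x := by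
  obtain ⟨a, ha⟩ := hu.2 K hK
  have h1 : u =ᶠ[nhds x] a := by
    filter_upwards [mem_interior_iff_mem_nhds.1 hx] with y hy using ha hy
  let a' : R3 →ᴬ[ℝ] V := ⟨a, a.continuous_of_finiteDimensional⟩
  have h2 : DifferentiableAt ℝ a x := a'.differentiableAt
  exact h1.differentiableAt_iff.2 h2

theorem IsP1.eqOn_of_eqOn_nodes {u w : R3 → V} (hu : M.IsP1 u) (hw : M.IsP1 w)
    (h : ∀ z ∈ M.nodes, u z = w z) {K : Finset R3} (hK : K ∈ M.elems) :
    Set.EqOn u w (convexHull ℝ (K : Set R3)) := by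
  obtain ⟨a, ha⟩ := hu.2 K hK
  obtain ⟨b, hb⟩ := hw.2 K hK
  have hab : Set.EqOn a b (K : Set R3) := fun z hz => by
    rw [← ha (subset_convexHull ℝ _ hz), ← hb (subset_convexHull ℝ _ hz),
      h z (M.mem_nodes hK hz)]
  exact fun x hx => by rw [ha hx, hb hx, eqOn_convexHull_of_eqOn hab hx]

end

/-! ### The stiffness matrix and monotonicity of the gradient norm. -/

open Classical in
/-- The vertices of the mesh as a finite set. -/
noncomputable def nodeFinset (M : TetMesh Ω) : Finset R3 := M.elems.biUnion id

theorem mem_nodeFinset {z : R3} : z ∈ M.nodeFinset ↔ z ∈ M.nodes := by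
  classical
  simp [nodeFinset, nodes]

/-- The partial derivatives of a piecewise affine function in terms of its nodal values. -/
theorem IsP1.partialDeriv_eq_sum {V : Type*} [NormedAddCommGroup V] [NormedSpace ℝ V]
    {w : R3 → V} (hw : M.IsP1 w) {φ : R3 → R3 → ℝ} (hφ : ∀ z ∈ M.nodes, M.IsHat z (φ z))
    {K : Finset R3} (hK : K ∈ M.elems) {x : R3} (hx : x ∈ cell K) (i : Fin 3) :
    partialDeriv i w x = ∑ z ∈ M.nodeFinset, partialDeriv i (φ z) x • w z := by
  classical
  have hP1 : ∀ z ∈ M.nodeFinset, M.IsP1 (φ z) := fun z hz => (hφ z (mem_nodeFinset.1 hz)).1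
  have hsum : M.IsP1 fun y => ∑ z ∈ M.nodeFinset, φ z y • w z :=
    IsP1.sum _ fun z hz => (hP1 z hz).smul_const _
  -- Both sides are piecewise affine with the same nodal values.
  have heq : Set.EqOn w (fun y => ∑ z ∈ M.nodeFinset, φ z y • w z)
      (convexHull ℝ (K : Set R3)) := by
    refine hw.eqOn_of_eqOn_nodes hsum (fun y hy => ?_) hK
    rw [Finset.sum_eq_single_of_mem y (mem_nodeFinset.2 hy)]
    · rw [(hφ y hy).2.1, one_smul]
    · intro z hz hzy
      rw [(hφ z (mem_nodeFinset.1 hz)).2.2 y hy hzy.symm, zero_smul]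
  have hev : w =ᶠ[nhds x] fun y => ∑ z ∈ M.nodeFinset, φ z y • w z := by
    filter_upwards [mem_interior_iff_mem_nhds.1 hx] with y hy using heq hy
  have hderiv : HasFDerivAt (fun y => ∑ z ∈ M.nodeFinset, φ z y • w z)
      (∑ z ∈ M.nodeFinset, (fderiv ℝ (φ z) x).smulRight (w z)) x :=
    HasFDerivAt.fun_sum fun z hz =>
      ((hP1 z hz).differentiableAt hK hx).hasFDerivAt.smul_const (w z)
  simp [partialDeriv, hev.fderiv_eq, hderiv.fderiv]

/-- The squared gradient norm as a quadratic form in the nodal values. -/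
theorem IsP1.gradNormSq_eq_sum {w : R3 → R3} (hw : M.IsP1 w) (hΩ : interior (closure Ω) = Ω)
    {φ : R3 → R3 → ℝ} (hφ : ∀ z ∈ M.nodes, M.IsHat z (φ z)) :
    gradNormSq Ω w = ∑ y ∈ M.nodeFinset, ∑ z ∈ M.nodeFinset,
      ⟪w y, w z⟫ * gradInner Ω (φ y) (φ z) := by
  have hP1 : ∀ z ∈ M.nodeFinset, M.IsP1 (φ z) := fun z hz => (hφ z (mem_nodeFinset.1 hz)).1
  have hpw : ∀ y ∈ M.nodeFinset, ∀ z ∈ M.nodeFinset, M.PwCont fun x =>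
      ⟪w y, w z⟫ * ∑ i : Fin 3, ⟪partialDeriv i (φ y) x, partialDeriv i (φ z) x⟫ :=
    fun y hy z hz => ((hP1 y hy).pwCont_gradInner (hP1 z hz)).const_mul _
  have hpw' : ∀ y ∈ M.nodeFinset, M.PwCont fun x => ∑ z ∈ M.nodeFinset,
      ⟪w y, w z⟫ * ∑ i : Fin 3, ⟪partialDeriv i (φ y) x, partialDeriv i (φ z) x⟫ :=
    fun y hy => PwCont.sum _ (hpw y hy)
  unfold gradNormSq gradInner
  rw [(hw.pwCont_gradInner hw).setIntegral_congr (PwCont.sum _ hpw') hΩ,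
    integral_finsetSum _ fun y hy => (hpw' y hy).integrableOn hΩ]
  · refine Finset.sum_congr rfl fun y hy => ?_
    rw [integral_finsetSum _ fun z hz => (hpw y hy z hz).integrableOn hΩ]
    exact Finset.sum_congr rfl fun z _ => integral_const_mul _ _
  · intro K hK x hx
    simp only [hw.partialDeriv_eq_sum hφ hK hx, sum_inner, inner_sum, Finset.mul_sum]
    rw [Finset.sum_comm]
    refine Finset.sum_congr rfl fun y _ => ?_
    rw [Finset.sum_comm]
    refine Finset.sum_congr rfl fun z _ => Finset.sum_congr rfl fun i _ => ?_
    simp only [real_inner_smul_left, real_inner_smul_right, RCLike.inner_apply,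
      conj_trivial]
    rw [real_inner_comm (w y) (w z)]
    ring

/-- The rows of the stiffness matrix sum to zero. -/
theorem sum_gradInner_hat_eq_zero (hΩ : interior (closure Ω) = Ω)
    {φ : R3 → R3 → ℝ} (hφ : ∀ z ∈ M.nodes, M.IsHat z (φ z)) {y : R3} (hy : y ∈ M.nodeFinset) :
    ∑ z ∈ M.nodeFinset, gradInner Ω (φ y) (φ z) = 0 := by
  have hP1 : ∀ z ∈ M.nodeFinset, M.IsP1 (φ z) := fun z hz => (hφ z (mem_nodeFinset.1 hz)).1
  have hpw : ∀ z ∈ M.nodeFinset, M.PwCont fun x =>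
      ∑ i : Fin 3, ⟪partialDeriv i (φ y) x, partialDeriv i (φ z) x⟫ :=
    fun z hz => (hP1 y hy).pwCont_gradInner (hP1 z hz)
  unfold gradInner
  rw [← integral_finsetSum _ fun z hz => (hpw z hz).integrableOn hΩ,
    (PwCont.sum _ hpw).setIntegral_congr (pwCont_const 0) hΩ, integral_zero]
  intro K hK x hx
  rw [Finset.sum_comm]
  refine Finset.sum_eq_zero fun i _ => ?_
  -- The nodal expansion of the constant 1 is the partition of unity; its derivative is zero.
  have h1 := (isP1_const (M := M) (1 : ℝ)).partialDeriv_eq_sum hφ hK hx i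
  have h2 : partialDeriv i (fun _ : R3 => (1 : ℝ)) x = 0 := by simp [partialDeriv]
  simp only [smul_eq_mul, mul_one, h2] at h1
  rw [← inner_sum, ← h1, inner_zero_right]

theorem gradInner_comm {V : Type*} [NormedAddCommGroup V] [InnerProductSpace ℝ V]
    (u w : R3 → V) : gradInner Ω u w = gradInner Ω w u := by
  simp only [gradInner, real_inner_comm]

/-- The squared gradient norm as a weighted sum of squared differences of nodal values. -/
theorem IsP1.gradNormSq_eq_sum_norm_sub_sq {w : R3 → R3} (hw : M.IsP1 w)
    (hΩ : interior (closure Ω) = Ω)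
    {φ : R3 → R3 → ℝ} (hφ : ∀ z ∈ M.nodes, M.IsHat z (φ z)) :
    gradNormSq Ω w = ∑ y ∈ M.nodeFinset, ∑ z ∈ M.nodeFinset,
      -(1 / 2) * gradInner Ω (φ y) (φ z) * ‖w y - w z‖ ^ 2 := by
  have h1 : ∑ y ∈ M.nodeFinset, ∑ z ∈ M.nodeFinset, ‖w y‖ ^ 2 * gradInner Ω (φ y) (φ z) = 0 :=
    Finset.sum_eq_zero fun y hy => by
      rw [← Finset.mul_sum, sum_gradInner_hat_eq_zero hΩ hφ hy, mul_zero]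
  have h2 : ∑ y ∈ M.nodeFinset, ∑ z ∈ M.nodeFinset, ‖w z‖ ^ 2 * gradInner Ω (φ y) (φ z) = 0 := by
    rw [Finset.sum_comm, ← h1]
    exact Finset.sum_congr rfl fun y _ => Finset.sum_congr rfl fun z _ => by
      rw [gradInner_comm]
  -- Polarization; the two squared-norm terms drop out because rows and columns of the stiffness
  -- matrix sum to zero.
  have h3 : ∀ y z : R3, -(1 / 2) * gradInner Ω (φ y) (φ z) * ‖w y - w z‖ ^ 2 =
      ⟪w y, w z⟫ * gradInner Ω (φ y) (φ z)
        - (1 / 2) * (‖w y‖ ^ 2 * gradInner Ω (φ y) (φ z))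
        - (1 / 2) * (‖w z‖ ^ 2 * gradInner Ω (φ y) (φ z)) := by
    intro y z
    rw [norm_sub_sq_real]
    ring
  rw [hw.gradNormSq_eq_sum hΩ hφ]
  simp only [h3, Finset.sum_sub_distrib, ← Finset.mul_sum _ _ (1 / 2 : ℝ)]
  rw [h1, h2]
  ring

/-- Under the angle condition, a contraction of the nodal values diminishes the gradient norm. -/
theorem gradNormSq_le_of_norm_sub_le (hΩ : interior (closure Ω) = Ω) (hM : M.AngleCondition)
    {u w : R3 → R3} (hu : M.IsP1 u) (hw : M.IsP1 w)
    (h : ∀ y ∈ M.nodes, ∀ z ∈ M.nodes, ‖w y - w z‖ ≤ ‖u y - u z‖) :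
    gradNormSq Ω w ≤ gradNormSq Ω u := by
  have hex : ∀ z ∈ M.nodes, ∃ φ, M.IsHat z φ := fun z hz => M.exists_isHat hz
  choose! φ hφ using hex
  rw [hu.gradNormSq_eq_sum_norm_sub_sq hΩ hφ, hw.gradNormSq_eq_sum_norm_sub_sq hΩ hφ]
  refine Finset.sum_le_sum fun y hy => Finset.sum_le_sum fun z hz => ?_
  rw [mem_nodeFinset] at hy hz
  -- Diagonal entries have the wrong sign but multiply a zero difference.
  by_cases hyz : y = z
  · simp [hyz]
  · have hA := hM y hy z hz hyz (φ y) (φ z) (hφ y hy) (hφ z hz)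
    have hsq := pow_le_pow_left₀ (norm_nonneg _) (h y hy z hz) 2
    exact mul_le_mul_of_nonneg_left hsq (by linarith)

end TetMesh

/-! ### Radial projection and the nodal update. -/

/-- Outside the open unit ball the radial projection onto the unit sphere is a contraction. -/
theorem norm_normalize_sub_normalize_le {a b : R3} (ha : 1 ≤ ‖a‖) (hb : 1 ≤ ‖b‖) :
    ‖‖a‖⁻¹ • a - ‖b‖⁻¹ • b‖ ≤ ‖a - b‖ := by
  have ha0 : 0 < ‖a‖ := by linarith
  have hb0 : 0 < ‖b‖ := by linarith
  refine le_of_sq_le_sq ?_ (norm_nonneg _)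
  rw [norm_sub_sq_real, norm_sub_sq_real, real_inner_smul_left, real_inner_smul_right,
    norm_smul, norm_smul, norm_inv, norm_inv, norm_norm, norm_norm, inv_mul_cancel₀ ha0.ne',
    inv_mul_cancel₀ hb0.ne']
  set c := ‖a‖⁻¹ * (‖b‖⁻¹ * ⟪a, b⟫) with hc
  have hin : ⟪a, b⟫ = ‖a‖ * ‖b‖ * c := by
    rw [hc]
    field_simp
  have hc1 : c ≤ 1 := by
    have := real_inner_le_norm a b
    rw [hin] at this
    have hab : 0 < ‖a‖ * ‖b‖ := mul_pos ha0 hb0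
    by_contra! hlt
    nlinarith
  have hab : 1 ≤ ‖a‖ * ‖b‖ := one_le_mul_of_one_le_of_one_le ha hb
  rw [hin]
  -- The difference of the two sides is (‖a‖ - ‖b‖)² + 2(‖a‖‖b‖ - 1)(1 - c), with c the cosine of
  -- the angle.
  nlinarith [sq_nonneg (‖a‖ - ‖b‖), mul_nonneg (sub_nonneg.2 hab) (sub_nonneg.2 hc1)]

section NodalUpdate

variable {a b : R3} {k : ℝ}

theorem norm_add_smul_sq (ha : ‖a‖ = 1) (hab : ⟪a, b⟫ = 0) :
    ‖a + k • b‖ ^ 2 = 1 + k ^ 2 * ‖b‖ ^ 2 := by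
  rw [norm_add_sq_real, real_inner_smul_right, hab, ha, norm_smul, mul_pow, Real.norm_eq_abs,
    sq_abs]
  ring

theorem one_le_norm_add_smul (ha : ‖a‖ = 1) (hab : ⟪a, b⟫ = 0) : 1 ≤ ‖a + k • b‖ := by
  have h := norm_add_smul_sq (k := k) ha hab
  refine le_of_sq_le_sq ?_ (norm_nonneg _)
  rw [h]
  nlinarith [mul_nonneg (sq_nonneg k) (sq_nonneg ‖b‖)]

theorem norm_normalize_add_smul (ha : ‖a‖ = 1) (hab : ⟪a, b⟫ = 0) :
    ‖‖a + k • b‖⁻¹ • (a + k • b)‖ = 1 := by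
  have h := one_le_norm_add_smul (k := k) ha hab
  rw [norm_smul, norm_inv, norm_norm, inv_mul_cancel₀ (by positivity)]

/-- The unit vector `a` is its own radial projection, so the contraction property applies. -/
theorem norm_normalize_add_smul_sub_le (ha : ‖a‖ = 1) (hab : ⟪a, b⟫ = 0) (hk : 0 ≤ k) :
    ‖‖a + k • b‖⁻¹ • (a + k • b) - a‖ ≤ k * ‖b‖ := by
  have h := norm_normalize_sub_normalize_le (one_le_norm_add_smul (k := k) ha hab) ha.ge
  simpa [ha, norm_smul, abs_of_nonneg hk] using h

/-- With u = a + k b the error is radial of length |u| - 1, and |u| - 1 ≤ (|u|² - 1)/2. -/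
theorem norm_normalize_add_smul_sub_sub_le (ha : ‖a‖ = 1) (hab : ⟪a, b⟫ = 0) :
    ‖‖a + k • b‖⁻¹ • (a + k • b) - a - k • b‖ ≤ k ^ 2 * ‖b‖ ^ 2 / 2 := by
  have h1 := one_le_norm_add_smul (k := k) ha hab
  have h2 := norm_add_smul_sq (k := k) ha hab
  set u := a + k • b with hu
  have h3 : ‖u‖⁻¹ • u - a - k • b = (‖u‖⁻¹ - 1) • u := by
    rw [sub_smul, one_smul, hu]
    abel
  have h4 : ‖u‖⁻¹ ≤ 1 := inv_le_one_of_one_le₀ h1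
  rw [h3, norm_smul, Real.norm_eq_abs, abs_of_nonpos (by linarith), neg_sub, sub_mul,
    inv_mul_cancel₀ (by positivity), one_mul]
  nlinarith [sq_nonneg (‖u‖ - 1)]

end NodalUpdate

/-! ### Local estimates for the curl and the mass on one element. -/

/-- The curl of a linear vector field. -/
noncomputable def curlLin (L : R3 →ₗ[ℝ] R3) : R3 :=
  !₂[L (EuclideanSpace.single 1 1) 2 - L (EuclideanSpace.single 2 1) 1,
     L (EuclideanSpace.single 2 1) 0 - L (EuclideanSpace.single 0 1) 2,
     L (EuclideanSpace.single 0 1) 1 - L (EuclideanSpace.single 1 1) 0]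

theorem curlLin_sub (L L' : R3 →ₗ[ℝ] R3) : curlLin (L - L') = curlLin L - curlLin L' := by
  ext i
  fin_cases i <;> simp [curlLin] <;> ring

theorem curlLin_smul (c : ℝ) (L : R3 →ₗ[ℝ] R3) : curlLin (c • L) = c • curlLin L := by
  ext i
  fin_cases i <;> simp [curlLin] <;> ring

theorem curl_eq_of_eqOn_affineMap {u : R3 → R3} {a : R3 →ᵃ[ℝ] R3} {s : Set R3}
    (hu : Set.EqOn u a s) {x : R3} (hx : x ∈ interior s) : curl u x = curlLin a.linear := by
  simp only [curl, curlLin, partialDeriv_eq_of_eqOn_affineMap hu hx]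

theorem norm_sq_eq (x : R3) : ‖x‖ ^ 2 = x 0 ^ 2 + x 1 ^ 2 + x 2 ^ 2 := by
  simp [EuclideanSpace.norm_sq_eq, Fin.sum_univ_three]

/-- The squared norm of the curl is at most twice that of the gradient. -/
theorem norm_curl_sq_le (u : R3 → R3) (x : R3) :
    ‖curl u x‖ ^ 2 ≤ 2 * ∑ i : Fin 3, ⟪partialDeriv i u x, partialDeriv i u x⟫ := by
  simp only [real_inner_self_eq_norm_sq, Fin.sum_univ_three, norm_sq_eq]
  simp only [curl, PiLp.toLp_apply, Matrix.cons_val]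
  nlinarith [sq_nonneg (partialDeriv 1 u x 2 + partialDeriv 2 u x 1),
    sq_nonneg (partialDeriv 2 u x 0 + partialDeriv 0 u x 2),
    sq_nonneg (partialDeriv 0 u x 1 + partialDeriv 1 u x 0), sq_nonneg (partialDeriv 0 u x 0),
    sq_nonneg (partialDeriv 1 u x 1), sq_nonneg (partialDeriv 2 u x 2)]

theorem norm_curlLin_le {L : R3 →ₗ[ℝ] R3} {G : ℝ}
    (hL : ∀ i, ‖L (EuclideanSpace.single i 1)‖ ≤ G) : ‖curlLin L‖ ≤ 4 * G := by
  have hG : 0 ≤ G := (norm_nonneg _).trans (hL 0)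
  have h : ∀ i, (L (EuclideanSpace.single i 1)) 0 ^ 2 + (L (EuclideanSpace.single i 1)) 1 ^ 2 +
      (L (EuclideanSpace.single i 1)) 2 ^ 2 ≤ G ^ 2 := fun i => by
    rw [← norm_sq_eq]
    exact pow_le_pow_left₀ (norm_nonneg _) (hL i) 2
  refine le_of_sq_le_sq ?_ (by positivity)
  rw [norm_sq_eq]
  simp only [curlLin, PiLp.toLp_apply, Matrix.cons_val]
  have h0 := h 0
  have h1 := h 1
  have h2 := h 2
  generalize L (EuclideanSpace.single 0 1) = p at *
  generalize L (EuclideanSpace.single 1 1) = q at *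
  generalize L (EuclideanSpace.single 2 1) = r at *
  nlinarith [sq_nonneg (q 2 + r 1), sq_nonneg (r 0 + p 2), sq_nonneg (p 1 + q 0),
    sq_nonneg (p 0), sq_nonneg (q 1), sq_nonneg (r 2), sq_nonneg G]

/-- This removes the precession term when the scheme is tested with `v`. -/
theorem inner_cross_self (a b : R3) : ⟪cross a b, b⟫ = 0 := by
  simp [cross, crossProduct, PiLp.inner_apply, Fin.sum_univ_three]
  ring

/-- The squared maximal nodal value of an affine map is controlled by its mean square. -/
theorem volume_mul_norm_sq_le {a : R3 →ᵃ[ℝ] R3} {K : Finset R3} {z : R3} (hz : z ∈ K)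
    (hmax : ∀ y ∈ K, ‖a y‖ ≤ ‖a z‖) :
    volume.real (cell K) * ‖a z‖ ^ 2 ≤ 256 * ∫ x in cell K, ⟪a x, a x⟫ := by
  set H := convexHull ℝ (K : Set R3) with hH
  -- Shrinking by 1/4 towards the maximizing vertex keeps |a| ≥ (3/4 - 1/4)|a(z)|. The squared bound
  -- 1/4 and the volume factor 1/64 give 256.
  set T := AffineMap.homothety z (1 / 4 : ℝ) '' H with hT
  have hzH : z ∈ H := subset_convexHull ℝ _ hz
  have hcont : Continuous fun x => ⟪a x, a x⟫ :=
    a.continuous_of_finiteDimensional.inner a.continuous_of_finiteDimensional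
  have hHc : IsCompact H := isCompact_convexHull_finset K
  have hTc : IsCompact T := hHc.image (AffineMap.continuous_of_finiteDimensional _)
  have hTH : T ⊆ H := by
    rintro _ ⟨y, hy, rfl⟩
    rw [AffineMap.homothety_eq_lineMap]
    exact (convex_convexHull ℝ _).lineMap_mem hzH hy ⟨by norm_num, by norm_num⟩
  have hvol : volume.real T = 1 / 64 * volume.real H := by
    rw [Measure.real, hT, Measure.addHaar_image_homothety, ENNReal.toReal_mul,
      ENNReal.toReal_ofReal (abs_nonneg _)]
    simp [Measure.real]
    norm_num
  have hlow : ∀ x ∈ T, ‖a z‖ ^ 2 / 4 ≤ ⟪a x, a x⟫ := by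
    rintro _ ⟨y, hy, rfl⟩
    have hay : ‖a y‖ ≤ ‖a z‖ := norm_affineMap_le_of_mem_convexHull hmax hy
    have h1 : a (AffineMap.homothety z (1 / 4 : ℝ) y) = (3 / 4 : ℝ) • a z + (1 / 4 : ℝ) • a y := by
      rw [AffineMap.homothety_eq_lineMap, AffineMap.apply_lineMap, AffineMap.lineMap_apply_module]
      norm_num
    have h2 : ‖a z‖ / 2 ≤ ‖a (AffineMap.homothety z (1 / 4 : ℝ) y)‖ := by
      have h3 := norm_sub_le ((3 / 4 : ℝ) • a z + (1 / 4 : ℝ) • a y) ((1 / 4 : ℝ) • a y)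
      rw [add_sub_cancel_right, norm_smul, norm_smul, ← h1] at h3
      norm_num at h3
      norm_num
      linarith
    rw [real_inner_self_eq_norm_sq]
    nlinarith [norm_nonneg (a z)]
  have hint : IntegrableOn (fun x => ⟪a x, a x⟫) H := hcont.continuousOn.integrableOn_compact hHc
  have h1 : volume.real T * (‖a z‖ ^ 2 / 4) ≤ ∫ x in T, ⟪a x, a x⟫ := by
    have := setIntegral_mono_on (f := fun _ => ‖a z‖ ^ 2 / 4) (μ := volume)
      (integrableOn_const hTc.measure_lt_top.ne) (hint.mono_set hTH) hTc.measurableSet hlow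
    simpa using this
  have h2 : ∫ x in T, ⟪a x, a x⟫ ≤ ∫ x in H, ⟪a x, a x⟫ :=
    setIntegral_mono_set hint (Filter.Eventually.of_forall fun x => real_inner_self_nonneg)
      hTH.eventuallyLE
  rw [setIntegral_congr_set (cell_ae_eq_convexHull K), measureReal_congr (cell_ae_eq_convexHull K)]
  rw [hvol] at h1
  linarith

/-- The change of the Dzyaloshinskii-Moriya density on one element during one time step, up to its
linearization. -/
theorem curl_increment_le {K : Finset R3} {am av ap : R3 →ᵃ[ℝ] R3} {k A B : ℝ} (hk : 0 ≤ k)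
    (hA : ∀ z ∈ K, ‖av z‖ ≤ A) (hm : ∀ z ∈ K, ‖am z‖ = 1) (hmv : ∀ z ∈ K, ⟪am z, av z⟫ = 0)
    (hp : ∀ z ∈ K, ap z = ‖am z + k • av z‖⁻¹ • (am z + k • av z))
    (hB : ∀ (a : R3 →ᵃ[ℝ] R3) (A' : ℝ), (∀ z ∈ K, ‖a z‖ ≤ A') → ‖curlLin a.linear‖ ≤ B * A')
    {x : R3} (hx : x ∈ convexHull ℝ (K : Set R3)) :
    ⟪curlLin ap.linear, ap x⟫ - ⟪curlLin am.linear, am x⟫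
      - k * ⟪curlLin am.linear, av x⟫ - k * ⟪am x, curlLin av.linear⟫ ≤ 2 * B * k ^ 2 * A ^ 2 := by
  obtain ⟨z, hz⟩ : (K : Set R3).Nonempty := convexHull_nonempty_iff.1 ⟨x, hx⟩
  have hA0 : 0 ≤ A := (norm_nonneg _).trans (hA z hz)
  have hB0 : 0 ≤ B := by
    have := (norm_nonneg _).trans (hB am 1 fun y hy => (hm y hy).le)
    linarith
  set d : R3 →ᵃ[ℝ] R3 := ap - am with hd
  set r : R3 →ᵃ[ℝ] R3 := d - k • av with hr
  have hdK : ∀ y ∈ K, ‖d y‖ ≤ k * A := fun y hy => by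
    have h1 := norm_normalize_add_smul_sub_le (hm y hy) (hmv y hy) hk
    rw [← hp y hy] at h1
    exact h1.trans (mul_le_mul_of_nonneg_left (hA y hy) hk)
  have hrK : ∀ y ∈ K, ‖r y‖ ≤ k ^ 2 * A ^ 2 / 2 := fun y hy => by
    have h1 := norm_normalize_add_smul_sub_sub_le (k := k) (hm y hy) (hmv y hy)
    rw [← hp y hy] at h1
    have h2 : ‖av y‖ ^ 2 ≤ A ^ 2 := pow_le_pow_left₀ (norm_nonneg _) (hA y hy) 2
    have h3 := mul_le_mul_of_nonneg_left h2 (sq_nonneg k)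
    exact h1.trans (by linarith)
  have hmK : ∀ y ∈ K, ‖am y‖ ≤ 1 := fun y hy => (hm y hy).le
  have hprod : ∀ {u w : R3} {s t : ℝ}, ‖u‖ ≤ s → ‖w‖ ≤ t → ⟪u, w⟫ ≤ s * t :=
    fun {u w s t} hu hw => (real_inner_le_norm u w).trans
      (mul_le_mul hu hw (norm_nonneg _) ((norm_nonneg _).trans hu))
  -- With d = k v + r, the quadratic increment minus its linear part is ⟨curl r, m⟩ + ⟨curl m, r⟩ +
  -- ⟨curl d, d⟩. The bounds are B k²A² times 1/2, 1/2 and 1.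
  have e1 := hprod (hB r _ hrK) (norm_affineMap_le_of_mem_convexHull hmK hx)
  have e2 := hprod (hB am _ hmK) (norm_affineMap_le_of_mem_convexHull hrK hx)
  have e3 := hprod (hB d _ hdK) (norm_affineMap_le_of_mem_convexHull hdK hx)
  have hcd : curlLin d.linear = curlLin ap.linear - curlLin am.linear := by
    rw [← curlLin_sub]
    rfl
  have hcr : curlLin r.linear = curlLin d.linear - k • curlLin av.linear := by
    rw [← curlLin_smul, ← curlLin_sub]
    rfl
  have hdx : d x = ap x - am x := rfl
  have hrx : r x = ap x - am x - k • av x := rfl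
  rw [hcr, hcd] at e1
  rw [hrx] at e2
  rw [hcd, hdx] at e3
  simp only [inner_sub_left, inner_sub_right, real_inner_smul_left, real_inner_smul_right]
    at e1 e2 e3
  rw [real_inner_comm (curlLin av.linear) (am x)]
  linarith

/-! ### The energy law for a single time step. -/

namespace TetMesh

variable {Ω : Set R3} {M : TetMesh Ω}

theorem IsP1.pwCont_curl {u : R3 → R3} (hu : M.IsP1 u) : M.PwCont (curl u) := by
  intro K hK
  obtain ⟨a, ha⟩ := hu.2 K hK
  exact ⟨fun _ => curlLin a.linear, continuous_const,
    fun x hx => curl_eq_of_eqOn_affineMap ha hx⟩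

/-- Inverse estimate for the curl on an element of a quasi-uniform mesh. -/
theorem QuasiUniform.norm_curlLin_le {κ h : ℝ} (hM : M.QuasiUniform κ h) (hκ : 1 ≤ κ)
    (hh : 0 < h) {K : Finset R3} (hK : K ∈ M.elems) {a : R3 →ᵃ[ℝ] R3} {A : ℝ}
    (ha : ∀ z ∈ K, ‖a z‖ ≤ A) : ‖curlLin a.linear‖ ≤ 8 * κ ^ 2 * h⁻¹ * A := by
  obtain ⟨⟨c, ρ, hball, hρ⟩, hlow, -⟩ := hM K hK
  have hκ0 : 0 < κ := by linarith
  obtain ⟨z, hz⟩ : K.Nonempty := Finset.card_pos.1 (by rw [M.card_eq_four K hK]; norm_num)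
  have hA0 : 0 ≤ A := (norm_nonneg _).trans (ha z hz)
  have h1 : h ≤ κ ^ 2 * ρ := by
    have h2 : κ⁻¹ * h ≤ κ * ρ := hlow.trans hρ
    rw [inv_mul_le_iff₀ hκ0] at h2
    linarith
  -- Positivity of the inner diameter is not part of quasi-uniformity; it follows from h ≤ κ²ρ.
  have hρ0 : 0 < ρ := by
    by_contra! hneg
    nlinarith [mul_nonneg (sq_nonneg κ) (neg_nonneg.2 hneg)]
  have hρinv : 1 / ρ ≤ κ ^ 2 * h⁻¹ := by
    rw [div_le_iff₀ hρ0]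
    field_simp
    linarith
  have h3 : ∀ i : Fin 3, ‖a.linear (EuclideanSpace.single i 1)‖ ≤ 2 * A / ρ := fun i =>
    norm_linear_le_of_closedBall hρ0
      (fun x hx => norm_affineMap_le_of_mem_convexHull ha (hball hx)) (by simp)
  refine (TPS.norm_curlLin_le h3).trans ?_
  calc 4 * (2 * A / ρ) = 8 * A * (1 / ρ) := by ring
    _ ≤ 8 * A * (κ ^ 2 * h⁻¹) := mul_le_mul_of_nonneg_left hρinv (by positivity)
    _ = _ := by ring

/-- The change of the Dzyaloshinskii-Moriya energy during one time step, up to its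
linearization. -/
theorem l2Inner_curl_increment_le (hΩ : interior (closure Ω) = Ω) {κ h k : ℝ}
    (hM : M.QuasiUniform κ h) (hκ : 1 ≤ κ) (hh : 0 < h) (hk : 0 ≤ k) {m v p : R3 → R3}
    (hm : m ∈ M.Admissible) (hv : v ∈ M.tangentSpace m) (hp : M.IsP1 p)
    (hup : ∀ z ∈ M.nodes, p z = ‖m z + k • v z‖⁻¹ • (m z + k • v z)) :
    l2Inner Ω (curl p) p ≤ l2Inner Ω (curl m) m
      + k * l2Inner Ω (curl m) v + k * l2Inner Ω m (curl v)
      + 4096 * κ ^ 2 * h⁻¹ * k ^ 2 * l2NormSq Ω v := by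
  have hP := hp.pwCont_curl.inner hp.pwCont
  have hMm := hm.1.pwCont_curl.inner hm.1.pwCont
  have hMv := (hm.1.pwCont_curl.inner hv.1.pwCont).const_mul k
  have hVm := (hm.1.pwCont.inner hv.1.pwCont_curl).const_mul k
  have hVv := (hv.1.pwCont.inner hv.1.pwCont).const_mul (4096 * κ ^ 2 * h⁻¹ * k ^ 2)
  have hR := ((hMm.add hMv).add hVm).add hVv
  have key : ∫ x in Ω, ⟪curl p x, p x⟫ ≤ ∫ x in Ω, (⟪curl m x, m x⟫ + k * ⟪curl m x, v x⟫
      + k * ⟪m x, curl v x⟫ + 4096 * κ ^ 2 * h⁻¹ * k ^ 2 * ⟪v x, v x⟫) := by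
    rw [hP.setIntegral_eq_sum hΩ, hR.setIntegral_eq_sum hΩ]
    refine Finset.sum_le_sum fun K hK => ?_
    obtain ⟨am, ham⟩ := hm.1.2 K hK
    obtain ⟨av, hav⟩ := hv.1.2 K hK
    obtain ⟨ap, hap⟩ := hp.2 K hK
    have hmem : ∀ {z}, z ∈ K → z ∈ convexHull ℝ (K : Set R3) := fun hz =>
      subset_convexHull ℝ _ hz
    obtain ⟨z, hz, hmax⟩ := K.exists_max_image (fun y => ‖av y‖)
      (Finset.card_pos.1 (by rw [M.card_eq_four K hK]; norm_num))
    have hpt : ∀ x ∈ cell K, ⟪curl p x, p x⟫ ≤ ⟪curl m x, m x⟫ + k * ⟪curl m x, v x⟫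
        + k * ⟪m x, curl v x⟫ + 2 * (8 * κ ^ 2 * h⁻¹) * k ^ 2 * ‖av z‖ ^ 2 := by
      intro x hx
      have hx' := interior_subset hx
      have := curl_increment_le (am := am) (av := av) (ap := ap) hk hmax
        (fun y hy => by rw [← ham (hmem hy)]; exact hm.2 y (M.mem_nodes hK hy))
        (fun y hy => by
          rw [← ham (hmem hy), ← hav (hmem hy)]; exact hv.2 y (M.mem_nodes hK hy))
        (fun y hy => by
          rw [← ham (hmem hy), ← hav (hmem hy), ← hap (hmem hy)]
          exact hup y (M.mem_nodes hK hy))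
        (fun a A' ha => hM.norm_curlLin_le hκ hh hK ha) hx'
      rw [curl_eq_of_eqOn_affineMap hap hx, curl_eq_of_eqOn_affineMap ham hx,
        curl_eq_of_eqOn_affineMap hav hx, hap hx', ham hx', hav hx']
      linarith
    have hL := (hMm.add hMv).add hVm
    have hmass := volume_mul_norm_sq_le (a := av) hz hmax
    have hcongr : ∫ x in cell K, ⟪av x, av x⟫ = ∫ x in cell K, ⟪v x, v x⟫ :=
      setIntegral_congr_fun (measurableSet_cell K) fun x hx => by
        simp only [hav (interior_subset hx)]
    have hconst : IntegrableOn (fun _ : R3 => 2 * (8 * κ ^ 2 * h⁻¹) * k ^ 2 * ‖av z‖ ^ 2)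
        (cell K) := integrableOn_const (volume_cell_lt_top K).ne
    have hmono := setIntegral_mono_on (hP.integrableOn_cell hK)
      ((hL.integrableOn_cell hK).add hconst) (measurableSet_cell K) hpt
    rw [integral_add' (hL.integrableOn_cell hK) hconst, setIntegral_const, smul_eq_mul] at hmono
    rw [integral_add (hL.integrableOn_cell hK) (hVv.integrableOn_cell hK), integral_const_mul]
    rw [hcongr] at hmass
    -- The factor 16 = 2 · 8 combines the increment bound and the inverse estimate; the mass
    -- comparison turns it into 16 · 256 = 4096.
    have hc : 0 ≤ 16 * κ ^ 2 * h⁻¹ * k ^ 2 := by positivity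
    have := mul_le_mul_of_nonneg_left hmass hc
    linarith
  rw [integral_add (((hMm.add hMv).add hVm).integrableOn hΩ) (hVv.integrableOn hΩ),
    integral_add ((hMm.add hMv).integrableOn hΩ) (hVm.integrableOn hΩ),
    integral_add (hMm.integrableOn hΩ) (hMv.integrableOn hΩ), integral_const_mul,
    integral_const_mul, integral_const_mul] at key
  exact key

theorem gradNormSq_add_smul (hΩ : interior (closure Ω) = Ω) {u w : R3 → R3} (hu : M.IsP1 u)
    (hw : M.IsP1 w) (k : ℝ) :
    gradNormSq Ω (fun x => u x + k • w x) =
      gradNormSq Ω u + 2 * k * gradInner Ω u w + k ^ 2 * gradNormSq Ω w := by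
  have hs := hu.add (hw.const_smul k)
  have h1 := hu.pwCont_gradInner hu
  have h2 := (hu.pwCont_gradInner hw).const_mul (2 * k)
  have h3 := (hw.pwCont_gradInner hw).const_mul (k ^ 2)
  unfold gradNormSq gradInner
  rw [(hs.pwCont_gradInner hs).setIntegral_congr ((h1.add h2).add h3) hΩ,
    integral_add ((h1.add h2).integrableOn hΩ) (h3.integrableOn hΩ),
    integral_add (h1.integrableOn hΩ) (h2.integrableOn hΩ), integral_const_mul,
    integral_const_mul]
  intro K hK x hx
  have hd : ∀ i, partialDeriv i (fun x => u x + k • w x) x =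
      partialDeriv i u x + k • partialDeriv i w x := fun i => by
    have h := ((hu.differentiableAt hK hx).hasFDerivAt.fun_add
      ((hw.differentiableAt hK hx).hasFDerivAt.fun_const_smul k)).fderiv
    simp only [partialDeriv]
    rw [h]
    simp
  simp only [hd, Finset.mul_sum, ← Finset.sum_add_distrib]
  refine Finset.sum_congr rfl fun i _ => ?_
  rw [inner_add_left, inner_add_right, inner_add_right, real_inner_smul_left,
    real_inner_smul_right, real_inner_smul_left, real_inner_smul_right,
    real_inner_comm (partialDeriv i u x) (partialDeriv i w x)]
  ring

/-- The energy law for a single time step. -/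
theorem energy_step_le (hΩ : interior (closure Ω) = Ω) {κ h α ℓex ℓdm θ k : ℝ}
    (hdm : 0 < ℓdm) (hM : M.QuasiUniform κ h) (hκ : 1 ≤ κ) (hh : 0 < h)
    (hang : M.AngleCondition) (hk : 0 ≤ k) {m v p : R3 → R3}
    (hm : m ∈ M.Admissible) (hv : v ∈ M.tangentSpace m) (hp : M.IsP1 p)
    (hup : ∀ z ∈ M.nodes, p z = ‖m z + k • v z‖⁻¹ • (m z + k • v z))
    (hvar : ∀ φ ∈ M.tangentSpace m,
      α * l2Inner Ω v φ + l2Inner Ω (fun x => cross (m x) (v x)) φ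
          + ℓex ^ 2 * θ * k * gradInner Ω v φ
        = - ℓex ^ 2 * gradInner Ω m φ - ℓdm / 2 * l2Inner Ω (curl m) φ
          - ℓdm / 2 * l2Inner Ω m (curl φ)) :
    energy Ω ℓex ℓdm p + (α - 2048 * κ ^ 2 * ℓdm * h⁻¹ * k) * k * l2NormSq Ω v
      + ℓex ^ 2 * (θ - 1 / 2) * k ^ 2 * gradNormSq Ω v ≤ energy Ω ℓex ℓdm m := by
  have hcross : l2Inner Ω (fun x => cross (m x) (v x)) v = 0 := by
    simp [l2Inner, inner_cross_self]
  have h1 := hvar v hv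
  have h2 := l2Inner_curl_increment_le hΩ hM hκ hh hk hm hv hp hup
  have h3 : gradNormSq Ω p ≤ gradNormSq Ω fun x => m x + k • v x := by
    refine gradNormSq_le_of_norm_sub_le hΩ hang (hm.1.add (hv.1.const_smul k)) hp ?_
    intro y hy z hz
    rw [hup y hy, hup z hz]
    exact norm_normalize_sub_normalize_le (one_le_norm_add_smul (hm.2 y hy) (hv.2 y hy))
      (one_le_norm_add_smul (hm.2 z hz) (hv.2 z hz))
  rw [gradNormSq_add_smul hΩ hm.1 hv.1] at h3
  rw [hcross] at h1
  change α * l2NormSq Ω v + 0 + ℓex ^ 2 * θ * k * gradNormSq Ω v = _ at h1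
  unfold energy
  have h4 := mul_le_mul_of_nonneg_left h3 (show 0 ≤ ℓex ^ 2 / 2 by positivity)
  have h5 := mul_le_mul_of_nonneg_left h2 (show 0 ≤ ℓdm / 2 by positivity)
  -- The tested equation cancels the mixed gradient and both linear curl terms. Implicitness
  -- contributes θ k²‖∇v‖², of which the square of the increment consumes one half.
  linear_combination h4 + h5 + k * h1

end TetMesh

/-! ### Summation over the time steps and stability. -/

theorem l2NormSq_nonneg (Ω : Set R3) (u : R3 → R3) : 0 ≤ l2NormSq Ω u :=
  integral_nonneg fun _ => real_inner_self_nonneg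

theorem gradNormSq_nonneg (Ω : Set R3) (u : R3 → R3) : 0 ≤ gradNormSq Ω u :=
  integral_nonneg fun _ => Finset.sum_nonneg fun _ _ => real_inner_self_nonneg

theorem h1Norm_sq (Ω : Set R3) (u : R3 → R3) :
    h1Norm Ω u ^ 2 = l2NormSq Ω u + gradNormSq Ω u :=
  Real.sq_sqrt (add_nonneg (l2NormSq_nonneg Ω u) (gradNormSq_nonneg Ω u))

namespace TetMesh

variable {Ω : Set R3} {M : TetMesh Ω}

theorem IsTPS1.admissible {α ℓex ℓdm θ k : ℝ} {N : ℕ} {m v : ℕ → R3 → R3}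
    (hs : M.IsTPS1 α ℓex ℓdm θ k N m v) {j : ℕ} (hj : j ≤ N) : m j ∈ M.Admissible := by
  induction j with
  | zero => exact hs.initial
  | succ j ih =>
    have hjN : j < N := hj
    have hm := ih hjN.le
    refine ⟨hs.isP1_succ j hjN, fun z hz => ?_⟩
    rw [hs.update j hjN z hz]
    exact norm_normalize_add_smul (hm.2 z hz) ((hs.tangent j hjN).2 z hz)

/-- The discrete energy law. -/
theorem IsTPS1.energy_le (hΩ : interior (closure Ω) = Ω) {κ h α ℓex ℓdm θ k : ℝ} {N : ℕ}
    {m v : ℕ → R3 → R3} (hs : M.IsTPS1 α ℓex ℓdm θ k N m v)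
    (hdm : 0 < ℓdm) (hM : M.QuasiUniform κ h) (hκ : 1 ≤ κ) (hh : 0 < h)
    (hang : M.AngleCondition) (hk : 0 ≤ k) {j : ℕ} (hj : j ≤ N) :
    energy Ω ℓex ℓdm (m j)
        + (α - 2048 * κ ^ 2 * ℓdm * h⁻¹ * k) * k * ∑ i ∈ Finset.range j, l2NormSq Ω (v i)
        + ℓex ^ 2 * (θ - 1 / 2) * k ^ 2 * ∑ i ∈ Finset.range j, gradNormSq Ω (v i)
      ≤ energy Ω ℓex ℓdm (m 0) := by
  induction j with
  | zero => simp
  | succ j ih =>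
    have hjN : j < N := hj
    have hstep := energy_step_le hΩ hdm hM hκ hh hang hk (hs.admissible hjN.le)
      (hs.tangent j hjN) (hs.isP1_succ j hjN) (hs.update j hjN) (hs.variational j hjN)
    have := ih hjN.le
    rw [Finset.sum_range_succ, Finset.sum_range_succ]
    linarith

/-- Unit nodal values and convexity of the ball give |m| ≤ 1 on every element. -/
theorem Admissible.l2NormSq_le (hΩ : interior (closure Ω) = Ω) {m : R3 → R3}
    (hm : m ∈ M.Admissible) : l2NormSq Ω m ≤ volume.real Ω := by
  have h := (hm.1.pwCont.inner hm.1.pwCont).setIntegral_mono (pwCont_const (1 : ℝ)) hΩ ?_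
  · simpa [l2NormSq, l2Inner] using h
  · intro K hK x hx
    obtain ⟨a, ha⟩ := hm.1.2 K hK
    have h1 : ‖a x‖ ≤ 1 := by
      refine norm_affineMap_le_of_mem_convexHull (fun z hz => ?_) (interior_subset hx)
      rw [← ha (subset_convexHull ℝ _ hz)]
      exact (hm.2 z (M.mem_nodes hK hz)).le
    rw [real_inner_self_eq_norm_sq, ha (interior_subset hx)]
    exact pow_le_one₀ (norm_nonneg _) h1

/-- The Dzyaloshinskii-Moriya energy is dominated by the exchange energy and the `L²` norm. -/
theorem IsP1.abs_dmi_le (hΩ : interior (closure Ω) = Ω) {m : R3 → R3} (hm : M.IsP1 m)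
    {ℓex ℓdm : ℝ} (hex : 0 < ℓex) (hdm : 0 < ℓdm) :
    |ℓdm / 2 * l2Inner Ω (curl m) m| ≤
      ℓex ^ 2 / 4 * gradNormSq Ω m + ℓdm ^ 2 / (2 * ℓex ^ 2) * l2NormSq Ω m := by
  have hC := hm.pwCont_curl.inner hm.pwCont
  have hG := (hm.pwCont_gradInner hm).const_mul (ℓex ^ 2 / 4)
  have hL := (hm.pwCont.inner hm.pwCont).const_mul (ℓdm ^ 2 / (2 * ℓex ^ 2))
  have hpt : ∀ x, ℓdm / 2 * |⟪curl m x, m x⟫| ≤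
      ℓex ^ 2 / 4 * ∑ i : Fin 3, ⟪partialDeriv i m x, partialDeriv i m x⟫
        + ℓdm ^ 2 / (2 * ℓex ^ 2) * ⟪m x, m x⟫ := by
    intro x
    have h1 := abs_real_inner_le_norm (curl m x) (m x)
    have h2 := norm_curl_sq_le m x
    rw [real_inner_self_eq_norm_sq (m x)]
    -- Young's inequality, weighted so that the bound |curl m|² ≤ 2|∇m|² costs exactly half of the
    -- exchange energy.
    have h3 : ℓdm / 2 * (‖curl m x‖ * ‖m x‖) ≤
        ℓex ^ 2 / 8 * ‖curl m x‖ ^ 2 + ℓdm ^ 2 / (2 * ℓex ^ 2) * ‖m x‖ ^ 2 := by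
      have h4 : ℓex ^ 2 / 8 * ‖curl m x‖ ^ 2 + ℓdm ^ 2 / (2 * ℓex ^ 2) * ‖m x‖ ^ 2
          - ℓdm / 2 * (‖curl m x‖ * ‖m x‖)
          = 1 / 2 * (ℓex / 2 * ‖curl m x‖ - ℓdm / ℓex * ‖m x‖) ^ 2 := by
        field_simp
        ring
      have h5 : 0 ≤ 1 / 2 * (ℓex / 2 * ‖curl m x‖ - ℓdm / ℓex * ‖m x‖) ^ 2 := by positivity
      linarith
    have h6 := mul_le_mul_of_nonneg_left h1 (show 0 ≤ ℓdm / 2 by positivity)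
    have h7 := mul_le_mul_of_nonneg_left h2 (show 0 ≤ ℓex ^ 2 / 8 by positivity)
    linarith
  have hup := (hC.const_mul (ℓdm / 2)).setIntegral_mono (hG.add hL) hΩ fun K _ x _ =>
    (mul_le_mul_of_nonneg_left (le_abs_self _) (by positivity)).trans (hpt x)
  have hlow := (hC.const_mul (-(ℓdm / 2))).setIntegral_mono (hG.add hL) hΩ fun K _ x _ => by
    rw [neg_mul, ← mul_neg]
    exact (mul_le_mul_of_nonneg_left (neg_le_abs _) (by positivity)).trans (hpt x)
  rw [integral_add (hG.integrableOn hΩ) (hL.integrableOn hΩ), integral_const_mul,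
    integral_const_mul, integral_const_mul] at hup hlow
  refine abs_le.2 ⟨?_, hup⟩
  have : -(ℓdm / 2 * l2Inner Ω (curl m) m) ≤
      ℓex ^ 2 / 4 * gradNormSq Ω m + ℓdm ^ 2 / (2 * ℓex ^ 2) * l2NormSq Ω m := by
    rw [← neg_mul]
    exact hlow
  linarith

/-- Stability of the scheme. -/
theorem IsTPS1.stability (hΩ : interior (closure Ω) = Ω) {κ h α ℓex ℓdm θ k C₀ : ℝ} {N : ℕ}
    {m v : ℕ → R3 → R3} (hs : M.IsTPS1 α ℓex ℓdm θ k N m v) (hα : 0 < α) (hex : 0 < ℓex)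
    (hdm : 0 < ℓdm) (hθ : 1 / 2 ≤ θ) (hM : M.QuasiUniform κ h) (hκ : 1 ≤ κ) (hh : 0 < h)
    (hang : M.AngleCondition) (hk : 0 ≤ k) (hkh : k ≤ α / (4096 * κ ^ 2 * ℓdm) * h)
    (hC₀ : h1Norm Ω (m 0) ≤ C₀) {j : ℕ} (hj : j ≤ N) :
    h1Norm Ω (m j) ^ 2 + k * ∑ i ∈ Finset.range j, l2NormSq Ω (v i)
        + (θ - 1 / 2) * k ^ 2 * ∑ i ∈ Finset.range j, gradNormSq Ω (v i)
      ≤ volume.real Ω + (5 / ℓex ^ 2 + 2 / α) *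
        (3 / 4 * ℓex ^ 2 * C₀ ^ 2 + ℓdm ^ 2 / ℓex ^ 2 * volume.real Ω) := by
  have hκ0 : 0 < κ := by linarith
  have hE := hs.energy_le hΩ hdm hM hκ hh hang hk hj
  have hmj := hs.admissible hj
  have hm0 := hs.admissible (Nat.zero_le N)
  have hβ : 0 ≤ ℓdm ^ 2 / (2 * ℓex ^ 2) := by positivity
  have hj1 := (abs_le.1 (hmj.1.abs_dmi_le hΩ hex hdm)).1
  have h01 := (abs_le.1 (hm0.1.abs_dmi_le hΩ hex hdm)).2
  have hj2 := Admissible.l2NormSq_le hΩ hmj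
  have hj3 := mul_le_mul_of_nonneg_left hj2 hβ
  have h03 := mul_le_mul_of_nonneg_left (Admissible.l2NormSq_le hΩ hm0) hβ
  have hg0 : gradNormSq Ω (m 0) ≤ C₀ ^ 2 := by
    have h1 := pow_le_pow_left₀ (Real.sqrt_nonneg _) hC₀ 2
    have h2 := h1Norm_sq Ω (m 0)
    have h3 := l2NormSq_nonneg Ω (m 0)
    change h1Norm Ω (m 0) ^ 2 ≤ C₀ ^ 2 at h1
    linarith
  have hg0' := mul_le_mul_of_nonneg_left hg0 (show 0 ≤ 3 / 4 * ℓex ^ 2 by positivity)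
  -- The time-step restriction is chosen so that the remainder consumes at most half of the damping.
  have hcoef : α / 2 ≤ α - 2048 * κ ^ 2 * ℓdm * h⁻¹ * k := by
    have h1 : 2048 * κ ^ 2 * ℓdm * h⁻¹ * k ≤
        2048 * κ ^ 2 * ℓdm * h⁻¹ * (α / (4096 * κ ^ 2 * ℓdm) * h) :=
      mul_le_mul_of_nonneg_left hkh (by positivity)
    have h2 : 2048 * κ ^ 2 * ℓdm * h⁻¹ * (α / (4096 * κ ^ 2 * ℓdm) * h) = α / 2 := by
      field_simp
      norm_num
    linarith
  rw [h1Norm_sq]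
  have hG := gradNormSq_nonneg Ω (m j)
  set S := ∑ i ∈ Finset.range j, l2NormSq Ω (v i)
  set R := ∑ i ∈ Finset.range j, gradNormSq Ω (v i)
  have hS : 0 ≤ k * S :=
    mul_nonneg hk (Finset.sum_nonneg fun i _ => l2NormSq_nonneg Ω (v i))
  have hR : 0 ≤ (θ - 1 / 2) * k ^ 2 * R :=
    mul_nonneg (mul_nonneg (by linarith) (sq_nonneg k))
      (Finset.sum_nonneg fun i _ => gradNormSq_nonneg Ω (v i))
  have hS' := mul_le_mul_of_nonneg_right hcoef hS
  set D := 3 / 4 * ℓex ^ 2 * C₀ ^ 2 + ℓdm ^ 2 / ℓex ^ 2 * volume.real Ω with hD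
  -- Absorption leaves 1/2 - 1/4 of the gradient at step j and costs 1/2 + 1/4 at step 0. Each of
  -- the two energies adds one volume term to `D`.
  have hmain : ℓex ^ 2 / 4 * gradNormSq Ω (m j) + α / 2 * (k * S)
      + ℓex ^ 2 * ((θ - 1 / 2) * k ^ 2 * R) ≤ D := by
    have hβ2 : ℓdm ^ 2 / ℓex ^ 2 * volume.real Ω =
        2 * (ℓdm ^ 2 / (2 * ℓex ^ 2) * volume.real Ω) := by
      field_simp
    unfold energy at hE
    rw [hD, hβ2]
    linarith
  have hex2 : 0 < ℓex ^ 2 := by positivity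
  have t1 : 0 ≤ ℓex ^ 2 / 4 * gradNormSq Ω (m j) := by positivity
  have t2 : 0 ≤ α / 2 * (k * S) := by positivity
  have t3 : 0 ≤ ℓex ^ 2 * ((θ - 1 / 2) * k ^ 2 * R) := mul_nonneg hex2.le hR
  have b1 : gradNormSq Ω (m j) ≤ 4 / ℓex ^ 2 * D := by
    rw [div_mul_eq_mul_div, le_div_iff₀ hex2]
    linarith
  have b2 : k * S ≤ 2 / α * D := by
    rw [div_mul_eq_mul_div, le_div_iff₀ hα]
    linarith
  have b3 : (θ - 1 / 2) * k ^ 2 * R ≤ 1 / ℓex ^ 2 * D := by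
    rw [div_mul_eq_mul_div, le_div_iff₀ hex2]
    linarith
  have b4 : (5 / ℓex ^ 2 + 2 / α) * D = 4 / ℓex ^ 2 * D + 2 / α * D + 1 / ℓex ^ 2 * D := by ring
  rw [b4]
  linarith

end TetMesh

end TPS

theorem proposition5p2 (κ ℓdm : ℝ) (hκ : 1 ≤ κ) (hdm : 0 < ℓdm) :
    -- discrete energy law, with a constant depending only on `κ` and `ℓdm`
    (∃ C : ℝ, 0 < C ∧
      ∀ (α ℓex θ : ℝ), 0 < α → 0 < ℓex → 0 ≤ θ → θ ≤ 1 →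
      ∀ (Ω : Set TPS.R3), interior (closure Ω) = Ω →
      ∀ (M : TPS.TetMesh Ω) (h : ℝ), 0 < h → M.QuasiUniform κ h → M.AngleCondition →
      ∀ (T : ℝ) (N : ℕ) (k : ℝ), 0 < T → 0 < N → k = T / N →
      ∀ (m v : ℕ → TPS.R3 → TPS.R3), M.IsTPS1 α ℓex ℓdm θ k N m v →
      ∀ j : ℕ, 1 ≤ j → j ≤ N →
        TPS.energy Ω ℓex ℓdm (m j)
          + (α - C * h⁻¹ * k) * k * ∑ i ∈ Finset.range j, TPS.l2NormSq Ω (v i)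
          + ℓex ^ 2 * (θ - 1 / 2) * k ^ 2 * ∑ i ∈ Finset.range j, TPS.gradNormSq Ω (v i)
        ≤ TPS.energy Ω ℓex ℓdm (m 0)) ∧
    -- stability, with `C'` depending only on `α`, `κ`, `ℓdm` and `C''` depending only on
    -- `α`, `C₀`, `κ`, `ℓex`, `ℓdm` and the volume `ω` of `Ω`
    (∀ α : ℝ, 0 < α → ∃ C' : ℝ, 0 < C' ∧
      ∀ (C₀ ℓex ω : ℝ), 0 < C₀ → 0 < ℓex → ∃ C'' : ℝ, 0 < C'' ∧
      ∀ θ : ℝ, 1 / 2 ≤ θ → θ ≤ 1 →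
      ∀ (Ω : Set TPS.R3), interior (closure Ω) = Ω → MeasureTheory.volume.real Ω = ω →
      ∀ (M : TPS.TetMesh Ω) (h : ℝ), 0 < h → M.QuasiUniform κ h → M.AngleCondition →
      ∀ (T : ℝ) (N : ℕ) (k : ℝ), 0 < T → 0 < N → k = T / N → k ≤ C' * h →
      ∀ (m v : ℕ → TPS.R3 → TPS.R3), M.IsTPS1 α ℓex ℓdm θ k N m v →
      TPS.h1Norm Ω (m 0) ≤ C₀ →
      ∀ j : ℕ, 1 ≤ j → j ≤ N →
        TPS.h1Norm Ω (m j) ^ 2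
          + k * ∑ i ∈ Finset.range j, TPS.l2NormSq Ω (v i)
          + (θ - 1 / 2) * k ^ 2 * ∑ i ∈ Finset.range j, TPS.gradNormSq Ω (v i)
        ≤ C'') := by
  have hκ0 : 0 < κ := by linarith
  refine ⟨⟨2048 * κ ^ 2 * ℓdm, by positivity, ?_⟩, fun α hα =>
    ⟨α / (4096 * κ ^ 2 * ℓdm), by positivity, fun C₀ ℓex ω hC₀ hex =>
      -- The number `ω` is fixed before the domain and may be any real; the absolute value keeps the
      -- constant positive.
      ⟨|ω| + (5 / ℓex ^ 2 + 2 / α) * (3 / 4 * ℓex ^ 2 * C₀ ^ 2 + ℓdm ^ 2 / ℓex ^ 2 * |ω|),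
        by positivity, ?_⟩⟩⟩
  · intro α ℓex θ _ _ _ _ Ω hΩ M h hh hM hang T N k hT hN hk m v hs j _ hj
    exact hs.energy_le hΩ hdm hM hκ hh hang (by rw [hk]; positivity) hj
  · intro θ hθ _ Ω hΩ hω M h hh hM hang T N k hT hN hk hkh m v hs hm0 j _ hj
    have hω0 : |ω| = MeasureTheory.volume.real Ω := by
      rw [← hω, abs_of_nonneg MeasureTheory.measureReal_nonneg]
    rw [hω0]
    exact hs.stability hΩ hα hex hdm hθ hM hκ hh hang (by rw [hk]; positivity) hkh hm0 hj
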